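/- Let $d\ge 1$ be an integer and let $\mathcal A=\mathcal Y=[0,1]^d$ with the $\ell_\infty$ distance. For $L>0$ let $\mathcal L_{\mathcal F^d_L}$ be the family of all losses $\ell:\mathcal A\times\mathcal Y\to[0,1]$ such that $y\mapsto \ell(a,y)$ is $L$-Lipschitz for every $a\in\mathcal A$ and $a\mapsto \ell(a,y)$ is $1$-Lipschitz for every $y\in\mathcal Y$ (both in $\ell_\infty$). Let $\mathcal X$ be a measurable feature space and let $\mathcal C$ be a finite nonempty collection of measurable policies $c:\mathcal X\to\mathcal A$. Given a prediction space $\mathcal P$ and measurable action selection rules $k^\ell:\mathcal P\to\mathcal A$ (one for each loss $\ell$), a randomized predictor $\pi:\mathcal X\to\Delta\mathcal P$ is an $(\mathcal L_{\mathcal F^d_L},\mathcal C,\varepsilon)$-omnipredictor for a distribution $\mathcal D$ on $\mathcal X\times\mathcal Y$ if for every $\ell\in\mathcal L_{\mathcal F^d_L}$ $$\max_{c\in\mathcal C}\ \mathbb E_{(x,y)\sim\mathcal D,\ p\sim\pi(x)}\big[\ell(k^\ell(p),y)-\ell(c(x),y)\big]\le\varepsilon .$$ Then for every constant $b>0$ there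 is a constant $K>0$, depending only on $b$, such that for all $d$, $L>0$, $\varepsilon>0$, $\mathcal X$ and $\mathcal C$ as above there are integers $T,n\ge 0$ with $$T\ \le\ K\cdot\frac{L^d\, d^{\,3d/2+1}\,\big(\ln^+(L|\mathcal C|/\varepsilon)\big)^{3d/2+1}}{\varepsilon^{4d+2}},\qquad \ln^+ u=\max(\ln u,0),$$ action selection rules $k^\ell:\mathcal P\to\mathcal A$ with prediction space $\mathcal P=[0,1]^n$, and an algorithm that maps every sample $S\in(\mathcal X\times\mathcal Y)^T$ to a randomized predictor $\pi_S:\mathcal X\to\Delta\mathcal P$ (measurably in $(S,x)$), for which the following holds. For every probability distribution $\mathcal D$ on $\mathcal X\times\mathcal Y$, if $S$ consists of $T$ i.i.d. draws from $\mathcal D$, then with probability at least $1-e^{-b/\varepsilon^{2d}}$ the predictor $\pi_S$ is an $(\mathcal L_{\mathcal F^d_L},\mathcal C,\varepsilon)$-omnipredictor for $\mathcal D$ with the rules $k^\ell$. The algorithm and the rules $k^\ell$ do not depend on $\mathcal D$, and the rules do not depend on the sample. -/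

import Mathlib

open MeasureTheory ProbabilityTheory
open scoped Real

/-- The cube `[0,1]^n`; its distance is the sup-norm distance, its σ-algebra the Borel one. -/
abbrev Cube (n : ℕ) : Type := Fin n → unitInterval

/-- The class of functions on `[0,1]^d` that are `L`-Lipschitz in the sup norm. -/
def lipschitzFunctions (d : ℕ) (L : ℝ) : Set (Cube d → ℝ) :=
  {f | ∀ y y' : Cube d, |f y - f y'| ≤ L * dist y y'}

/-- The loss family of a function class `F` on `[0,1]^d`, with action space `[0,1]^d`: all
losses `ℓ` with values in `[0,1]` such that `ℓ(a, ·) ∈ F` for every action `a` and such that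
`ℓ(·, y)` is `1`-Lipschitz in the sup norm for every outcome `y`. -/
def lossFamily {d : ℕ} (F : Set (Cube d → ℝ)) : Set (Cube d → Cube d → ℝ) :=
  {ℓ | (∀ a y, ℓ a y ∈ Set.Icc (0 : ℝ) 1) ∧ (∀ a, ℓ a ∈ F) ∧
    ∀ a a' y, |ℓ a y - ℓ a' y| ≤ dist a a'}

/-- The randomized predictor `pred : 𝒳 → Δ(𝒬)` is an `(ℒ, 𝒞, ε)`-omnipredictor for the joint
distribution `D` of `(x, y)` when every decision maker with a loss `ℓ ∈ ℒ` turns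
predictions into actions by the rule `k ℓ : 𝒬 → 𝒜`. -/
def IsOmnipredictor {𝒳 𝒬 𝒜 𝒴 : Type*} [MeasurableSpace 𝒳] [MeasurableSpace 𝒬]
    [MeasurableSpace 𝒜] [MeasurableSpace 𝒴]
    (ℒ : Set (𝒜 → 𝒴 → ℝ)) (𝒞 : Set (𝒳 → 𝒜)) (ε : ℝ) (D : Measure (𝒳 × 𝒴))
    (k : (𝒜 → 𝒴 → ℝ) → 𝒬 → 𝒜) (pred : Kernel 𝒳 𝒬) : Prop :=
  ∀ ℓ ∈ ℒ, Measurable (k ℓ) ∧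
    ∀ c ∈ 𝒞, ∫ z, ∫ p, (ℓ (k ℓ p) z.2 - ℓ (c z.1) z.2) ∂(pred z.1) ∂D ≤ ε

/-! The prediction need not resemble an outcome: its dimension is free, so it can simply list
recommended actions. Rounding the values of a loss on a product grid of mesh about `ε` in the action
and `ε / L` in the outcome gives a finite cover of the loss family (`abs_sub_le_of_lossCode_eq`).
For each cover element an empirical risk minimizer over `𝒞` is chosen; the prediction at `x`
concatenates their actions, and `k ℓ` reads the block of the cell of `ℓ`. Hoeffding and a union
bound over cover elements and policies give the guarantee.

The logarithm of the cover size is of order `(676 L / ε²)^d / ε`, and `2d + 1 ≤ 4d` leaves room in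
the claimed rate. Factors exponential in `d` are absorbed by `d ^ (3d/2 + 1)`. The claimed bound can
be too small for any sampling when `ε ≥ 1`, `|𝒞| = 1` or `L ≤ ε`; there a fixed rule works with `T =
0`. -/

/-! ### Concentration -/

/-- Two-sided Hoeffding inequality for the sum of a bounded function over an i.i.d. sample. -/
lemma hoeffding_pi {Ω : Type*} [MeasurableSpace Ω] (D : Measure Ω) [IsProbabilityMeasure D]
    (T : ℕ) {f : Ω → ℝ} (hf : Measurable f) (hf01 : ∀ z, f z ∈ Set.Icc (0 : ℝ) 1)
    {τ : ℝ} (hτ : 0 ≤ τ) :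
    (Measure.pi fun _ : Fin T => D).real
      {S | T * τ ≤ |∑ i, (f (S i) - ∫ z, f z ∂D)|} ≤ 2 * Real.exp (-(2 * T * τ ^ 2)) := by
  have one_sided : ∀ g : Ω → ℝ, Measurable g → ∀ a b : ℝ, b - a = 1 →
      (∀ z, g z ∈ Set.Icc a b) →
      (Measure.pi fun _ : Fin T => D).real
        {S | T * τ ≤ ∑ i, (g (S i) - ∫ z, g z ∂D)} ≤ Real.exp (-(2 * T * τ ^ 2)) := by
    intro g hg a b hab hg01
    have hind : iIndepFun (fun (i : Fin T) (S : Fin T → Ω) => g (S i) - ∫ z, g z ∂D)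
        (Measure.pi fun _ : Fin T => D) :=
      iIndepFun_pi (X := fun _ z => g z - ∫ z, g z ∂D) fun _ => (hg.sub_const _).aemeasurable
    have hsub : ∀ i ∈ (Finset.univ : Finset (Fin T)),
        HasSubgaussianMGF (fun S : Fin T → Ω => g (S i) - ∫ z, g z ∂D) ((‖b - a‖₊ / 2) ^ 2)
          (Measure.pi fun _ : Fin T => D) := by
      intro i _
      have h := hasSubgaussianMGF_of_mem_Icc (μ := Measure.pi fun _ : Fin T => D)
        (X := fun S : Fin T → Ω => g (S i)) (a := a) (b := b)
        (hg.comp (measurable_pi_apply i)).aemeasurable (ae_of_all _ fun S => hg01 (S i))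
      have hint : ∫ S : Fin T → Ω, g (S i) ∂(Measure.pi fun _ : Fin T => D) = ∫ z, g z ∂D := by
        have hmp := measurePreserving_eval (fun _ : Fin T => D) i
        conv_rhs => rw [← hmp.map_eq]
        exact (integral_map hmp.measurable.aemeasurable hg.aestronglyMeasurable).symm
      rwa [hint] at h
    refine (HasSubgaussianMGF.measure_sum_ge_le_of_iIndepFun hind hsub
      (mul_nonneg T.cast_nonneg hτ)).trans (Real.exp_le_exp.2 ?_)
    -- The exponent `(Tτ)² / (2 · T/4) = 2Tτ²` needs a cancellation of `T`.
    rcases T.eq_zero_or_pos with rfl | hT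
    · simp
    have hT' : (0 : ℝ) < T := by exact_mod_cast hT
    rw [hab]
    simp only [Finset.sum_const, Finset.card_univ, Fintype.card_fin, nsmul_eq_mul]
    push_cast
    rw [norm_one]
    apply le_of_eq
    field_simp
  have hneg := one_sided (fun z => -f z) hf.neg (-1) 0 (by norm_num)
    fun z => ⟨by linarith [(hf01 z).2], by linarith [(hf01 z).1]⟩
  have hpos := one_sided f hf 0 1 (by norm_num) hf01
  calc _ ≤ (Measure.pi fun _ : Fin T => D).real
        ({S | T * τ ≤ ∑ i, (f (S i) - ∫ z, f z ∂D)} ∪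
          {S | T * τ ≤ ∑ i, (-f (S i) - ∫ z, -f z ∂D)}) := by
        refine measureReal_mono fun S hS => ?_
        rcases le_abs.1 (show T * τ ≤ |∑ i, (f (S i) - ∫ z, f z ∂D)| from hS) with h | h
        · exact Or.inl h
        · refine Or.inr ?_
          rw [← Finset.sum_neg_distrib] at h
          simpa [integral_neg, neg_add_eq_sub] using h
    _ ≤ _ := (measureReal_union_le _ _).trans (by linarith)

/-! ### Measurable empirical risk minimization -/

/-- A minimizer of finitely many measurable functions can be selected measurably. -/
lemma exists_measurable_argmin {Ω ι : Type*} [MeasurableSpace Ω] [MeasurableSpace ι] [Finite ι]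
    [Nonempty ι] {v : Ω → ι → ℝ} (hv : ∀ i, Measurable fun ω => v ω i) :
    ∃ g : Ω → ι, Measurable g ∧ ∀ ω i, v ω (g ω) ≤ v ω i := by
  classical
  -- The choice depends only on the pattern of comparisons, which ranges over a finite type, so any
  -- selection from it is measurable.
  let F : (ι → ι → Prop) → ι := fun R =>
    if h : ∃ i, ∀ j, R i j then h.choose else Classical.arbitrary ι
  refine ⟨fun ω => F fun i j => v ω i ≤ v ω j, ?_, fun ω => ?_⟩
  · refine (measurable_of_finite F).comp ?_
    exact measurable_pi_lambda _ fun i => measurable_pi_lambda _ fun j =>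
      measurableSet_setOfPred.1 (measurableSet_le (hv i) (hv j))
  · have h : ∃ i, ∀ j, v ω i ≤ v ω j := Finite.exists_min (v ω)
    simp only [F, dif_pos h]
    exact h.choose_spec

/-! ### Losses -/

lemma lossFamily.abs_sub_le {d : ℕ} {L : ℝ} {ℓ : Cube d → Cube d → ℝ}
    (hℓ : ℓ ∈ lossFamily (lipschitzFunctions d L)) (a a' y y' : Cube d) :
    |ℓ a y - ℓ a' y'| ≤ dist a a' + L * dist y y' :=
  (_root_.abs_sub_le _ (ℓ a' y) _).trans (add_le_add (hℓ.2.2 a a' y) (hℓ.2.1 a' y y'))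

lemma lossFamily.continuous {d : ℕ} {L : ℝ} {ℓ : Cube d → Cube d → ℝ}
    (hℓ : ℓ ∈ lossFamily (lipschitzFunctions d L)) :
    Continuous fun z : Cube d × Cube d => ℓ z.1 z.2 := by
  refine continuous_iff_continuousAt.2 fun z => ?_
  rw [ContinuousAt, tendsto_iff_dist_tendsto_zero]
  have h : Filter.Tendsto (fun w : Cube d × Cube d => dist w.1 z.1 + L * dist w.2 z.2) (nhds z)
      (nhds 0) := by
    have : Continuous fun w : Cube d × Cube d => dist w.1 z.1 + L * dist w.2 z.2 := by fun_prop
    simpa using this.tendsto z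
  exact squeeze_zero (fun _ => dist_nonneg)
    (fun w => by simpa [Real.dist_eq] using lossFamily.abs_sub_le hℓ w.1 z.1 w.2 z.2) h

lemma lossFamily.measurable_comp {Ω : Type*} [MeasurableSpace Ω] {d : ℕ} {L : ℝ}
    {ℓ : Cube d → Cube d → ℝ} (hℓ : ℓ ∈ lossFamily (lipschitzFunctions d L))
    {f g : Ω → Cube d} (hf : Measurable f) (hg : Measurable g) :
    Measurable fun ω => ℓ (f ω) (g ω) :=
  (lossFamily.continuous hℓ).measurable.comp (hf.prodMk hg)

/-! ### Covering the loss family -/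

/-- The index of the cell of width `1 / N` that contains a point of the unit interval. -/
noncomputable def gridIndex (N : ℕ) (t : unitInterval) : Fin (N + 1) :=
  ⟨⌊(t : ℝ) * N⌋₊, Nat.lt_succ_of_le (Nat.floor_le_of_le (by
    simpa using mul_le_of_le_one_left N.cast_nonneg t.2.2))⟩

/-- The corner of a cell of width `1 / N`. -/
noncomputable def gridPoint {N : ℕ} (i : Fin (N + 1)) : unitInterval :=
  ⟨(i : ℝ) / N, by positivity, div_le_one_of_le₀ (by exact_mod_cast i.is_le) N.cast_nonneg⟩

lemma dist_le_of_gridIndex_eq {N : ℕ} (hN : 0 < N) {s t : unitInterval}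
    (h : gridIndex N s = gridIndex N t) : |(s : ℝ) - t| ≤ 1 / N := by
  have hN' : (0 : ℝ) < N := by exact_mod_cast hN
  have h' : ⌊(s : ℝ) * N⌋₊ = ⌊(t : ℝ) * N⌋₊ := congrArg Fin.val h
  have hs := Nat.floor_le (mul_nonneg s.2.1 hN'.le)
  have ht := Nat.floor_le (mul_nonneg t.2.1 hN'.le)
  have hs' := Nat.lt_floor_add_one ((s : ℝ) * N)
  have ht' := Nat.lt_floor_add_one ((t : ℝ) * N)
  rw [h'] at hs hs'
  rw [abs_le, ← neg_div, div_le_iff₀ hN', le_div_iff₀ hN']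
  constructor <;> nlinarith

lemma dist_gridPoint_gridIndex_le {N : ℕ} (hN : 0 < N) (t : unitInterval) :
    dist t (gridPoint (gridIndex N t)) ≤ 1 / N := by
  have hN' : (0 : ℝ) < N := by exact_mod_cast hN
  have ht := Nat.floor_le (mul_nonneg t.2.1 hN'.le)
  have ht' := Nat.lt_floor_add_one ((t : ℝ) * N)
  rw [Subtype.dist_eq, Real.dist_eq]
  simp only [gridPoint, gridIndex]
  rw [abs_le, ← neg_div, div_le_iff₀ hN', le_div_iff₀ hN', sub_mul, div_mul_cancel₀ _ hN'.ne']
  constructor <;> linarith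

lemma exists_grid_dist_le {N : ℕ} (hN : 0 < N) {d : ℕ} (y : Cube d) :
    ∃ i : Fin d → Fin (N + 1), dist y (fun m => gridPoint (i m)) ≤ 1 / N :=
  ⟨fun m => gridIndex N (y m), (dist_pi_le_iff (by positivity)).2
    fun m => dist_gridPoint_gridIndex_le hN (y m)⟩

/-- The values of a loss on a product grid, rounded to precision `1 / M`. -/
abbrev LossCode (d N₁ N₂ M : ℕ) : Type :=
  (Fin d → Fin (N₁ + 1)) × (Fin d → Fin (N₂ + 1)) → Fin (M + 1)

/-- The rounded values of a loss on a product grid. -/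
noncomputable def lossCode {d : ℕ} (N₁ N₂ M : ℕ) (ℓ : Cube d → Cube d → ℝ) :
    LossCode d N₁ N₂ M := fun i =>
  gridIndex M (Set.projIcc 0 1 zero_le_one
    (ℓ (fun m => gridPoint (i.1 m)) (fun m => gridPoint (i.2 m))))

/-- Moving to a nearby grid point costs `1/N₁ + L/N₂` for each loss; there, equal codes leave a gap
of at most `1/M`. -/
lemma abs_sub_le_of_lossCode_eq {d N₁ N₂ M : ℕ} (h₁ : 0 < N₁) (h₂ : 0 < N₂) (hM : 0 < M)
    {L : ℝ} (hL : 0 ≤ L) {ℓ ℓ' : Cube d → Cube d → ℝ}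
    (hℓ : ℓ ∈ lossFamily (lipschitzFunctions d L))
    (hℓ' : ℓ' ∈ lossFamily (lipschitzFunctions d L))
    (h : lossCode N₁ N₂ M ℓ = lossCode N₁ N₂ M ℓ') (a y : Cube d) :
    |ℓ a y - ℓ' a y| ≤ 2 * (1 / N₁ + L * (1 / N₂)) + 1 / M := by
  obtain ⟨i, hi⟩ := exists_grid_dist_le h₁ a
  obtain ⟨j, hj⟩ := exists_grid_dist_le h₂ y
  have hc := dist_le_of_gridIndex_eq hM (congrFun h (i, j))
  rw [Set.projIcc_of_mem _ (hℓ.1 _ _), Set.projIcc_of_mem _ (hℓ'.1 _ _)] at hc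
  have e₁ := lossFamily.abs_sub_le hℓ a (fun m => gridPoint (i m)) y (fun m => gridPoint (j m))
  have e₂ := lossFamily.abs_sub_le hℓ' a (fun m => gridPoint (i m)) y (fun m => gridPoint (j m))
  have := mul_le_mul_of_nonneg_left hj hL
  simp only [abs_le] at *
  constructor <;> linarith [e₁.1, e₁.2, e₂.1, e₂.2, hc.1, hc.2]

/-! ### Omnipredictors -/

/-- Without integrability the integral is `0` by convention, which is where `0 ≤ ε` enters. -/
lemma integral_le_of_forall_le {Ω : Type*} [MeasurableSpace Ω] (D : Measure Ω)
    [IsProbabilityMeasure D] {f : Ω → ℝ} {ε : ℝ} (hε : 0 ≤ ε) (h : ∀ z, f z ≤ ε) :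
    ∫ z, f z ∂D ≤ ε := by
  by_cases hf : Integrable f D
  · simpa using integral_mono hf (integrable_const ε) h
  · rwa [integral_undef hf]

/-- If every loss has a rule that is almost optimal on all outcomes, no sample is needed. -/
lemma exists_omnipredictor_of_forall_le {𝒳 : Type*} [MeasurableSpace 𝒳] {d : ℕ}
    {ℒ : Set (Cube d → Cube d → ℝ)} {𝒞 : Set (𝒳 → Cube d)} {ε : ℝ} (hε : 0 ≤ ε)
    {p : 𝒳 → Cube d} (hp : Measurable p) {k : (Cube d → Cube d → ℝ) → Cube d → Cube d}
    (hk : ∀ ℓ ∈ ℒ, Measurable (k ℓ))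
    (h : ∀ ℓ ∈ ℒ, ∀ c ∈ 𝒞, ∀ x y, ℓ (k ℓ (p x)) y - ℓ (c x) y ≤ ε) :
    ∃ alg : Kernel ((Fin 0 → 𝒳 × Cube d) × 𝒳) (Cube d), IsMarkovKernel alg ∧
      ∀ D : Measure (𝒳 × Cube d), IsProbabilityMeasure D → ∀ S,
        IsOmnipredictor ℒ 𝒞 ε D k (alg.sectR S) := by
  refine ⟨Kernel.deterministic (fun z => p z.2) (hp.comp measurable_snd), inferInstance,
    fun D _ S ℓ hℓ => ⟨hk ℓ hℓ, fun c hc => integral_le_of_forall_le D hε fun z => ?_⟩⟩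
  rw [Kernel.sectR_apply, Kernel.deterministic_apply, integral_dirac]
  exact h ℓ hℓ c hc _ _

/-- The prediction that lists the actions of empirical risk minimizers, one for each element of a
finite cover of the losses, is an omnipredictor whenever the empirical losses are accurate. -/
lemma isOmnipredictor_of_erm {𝒳 J : Type*} [MeasurableSpace 𝒳] {d n T : ℕ} (hT : 0 < T)
    (e : Fin n ≃ J × Fin d) {L ε : ℝ} {𝒞 : Finset (𝒳 → Cube d)} (h𝒞 : ∀ c ∈ 𝒞, Measurable c)
    {rep : J → Cube d → Cube d → ℝ} (hrep : ∀ j, rep j ∈ lossFamily (lipschitzFunctions d L))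
    {code : (Cube d → Cube d → ℝ) → J}
    (hcode : ∀ ℓ ∈ lossFamily (lipschitzFunctions d L), ∀ a y,
      |ℓ a y - rep (code ℓ) a y| ≤ ε / 4)
    (D : Measure (𝒳 × Cube d)) [IsProbabilityMeasure D] (S : Fin T → 𝒳 × Cube d)
    (g : J → 𝒞)
    (hg : ∀ j (c : 𝒞), ∑ i, rep j ((g j : 𝒳 → Cube d) (S i).1) (S i).2
      ≤ ∑ i, rep j ((c : 𝒳 → Cube d) (S i).1) (S i).2)
    (hS : ∀ j (c : 𝒞), |∑ i, (rep j ((c : 𝒳 → Cube d) (S i).1) (S i).2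
      - ∫ z, rep j ((c : 𝒳 → Cube d) z.1) z.2 ∂D)| < T * (ε / 4))
    (pred : Kernel 𝒳 (Cube n))
    (hpred : ∀ x, pred x = Measure.dirac
      fun m => (g (e m).1 : 𝒳 → Cube d) x (e m).2) :
    IsOmnipredictor (lossFamily (lipschitzFunctions d L)) (𝒞 : Set (𝒳 → Cube d)) ε D
      (fun ℓ p m => p (e.symm (code ℓ, m))) pred := by
  refine fun ℓ hℓ => ⟨by fun_prop, fun c hc => ?_⟩
  set j := code ℓ
  set ĉ : 𝒳 → Cube d := (g j).1 with hĉ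
  have hint : ∀ ℓ' ∈ lossFamily (lipschitzFunctions d L), ∀ c' ∈ 𝒞,
      Integrable (fun z : 𝒳 × Cube d => ℓ' (c' z.1) z.2) D := fun ℓ' hℓ' c' hc' =>
    Integrable.of_mem_Icc 0 1 (lossFamily.measurable_comp hℓ'
      ((h𝒞 c' hc').comp measurable_fst) measurable_snd).aemeasurable
      (ae_of_all _ fun z => hℓ'.1 _ _)
  have hpt : ∀ z : 𝒳 × Cube d, ∫ p, (ℓ (fun m => p (e.symm (j, m))) z.2 - ℓ (c z.1) z.2)
      ∂(pred z.1) = ℓ (ĉ z.1) z.2 - ℓ (c z.1) z.2 := by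
    intro z
    rw [hpred, integral_dirac]
    simp [hĉ]
  have hclose : ∀ c' ∈ 𝒞, |∫ z, ℓ (c' z.1) z.2 ∂D - ∫ z, rep j (c' z.1) z.2 ∂D| ≤ ε / 4 := by
    intro c' hc'
    rw [← integral_sub (hint ℓ hℓ c' hc') (hint _ (hrep j) c' hc')]
    have := norm_integral_le_of_norm_le_const (μ := D) (C := ε / 4)
      (f := fun z : 𝒳 × Cube d => ℓ (c' z.1) z.2 - rep j (c' z.1) z.2)
      (ae_of_all _ fun z => hcode ℓ hℓ _ _)
    simpa using this
  refine (integral_congr_ae (ae_of_all _ hpt)).trans_le ?_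
  rw [integral_sub (hint ℓ hℓ _ (g j).2) (hint ℓ hℓ c hc)]
  have hT' : (0 : ℝ) < T := by exact_mod_cast hT
  have h₁ := hS j (g j)
  have h₂ := hS j ⟨c, hc⟩
  have h₃ := hg j ⟨c, hc⟩
  simp only [Finset.sum_sub_distrib, Finset.sum_const, Finset.card_univ, Fintype.card_fin,
    nsmul_eq_mul, abs_lt] at h₁ h₂ h₃
  have h₄ := abs_le.1 (hclose ĉ (g j).2)
  have h₅ := abs_le.1 (hclose c hc)
  -- Sampling error costs `ε/4` at each of `ĉ` and `c`; replacing `ℓ` by its representative costs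
  -- `ε/4` at each again.
  have h₆ : ∫ z, rep j (ĉ z.1) z.2 ∂D - ∫ z, rep j (c z.1) z.2 ∂D ≤ ε / 2 := by
    refine le_of_mul_le_mul_left ?_ hT'
    linarith [h₁.1, h₂.2]
  linarith [h₄.2, h₅.1]

/-- Empirical risk minimization over a finite cover of the losses. -/
lemma exists_omnipredictor_of_card_le {𝒳 : Type*} [MeasurableSpace 𝒳] {d N₁ N₂ M T : ℕ}
    (h₁ : 0 < N₁) (h₂ : 0 < N₂) (hM : 0 < M) (hT : 0 < T) {L ε β : ℝ} (hL : 0 ≤ L) (hε : 0 ≤ ε)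
    (hcover : 2 * (1 / N₁ + L * (1 / N₂)) + 1 / M ≤ ε / 4)
    {𝒞 : Finset (𝒳 → Cube d)} (hne : 𝒞.Nonempty) (h𝒞 : ∀ c ∈ 𝒞, Measurable c)
    (hcard : Real.log (2 * 𝒞.card) + ((N₁ + 1) ^ d * (N₂ + 1) ^ d : ℝ) * Real.log (M + 1) + β
      ≤ T * ε ^ 2 / 8) :
    ∃ (n : ℕ) (k : (Cube d → Cube d → ℝ) → Cube n → Cube d)
      (alg : Kernel ((Fin T → 𝒳 × Cube d) × 𝒳) (Cube n)), IsMarkovKernel alg ∧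
      ∀ D : Measure (𝒳 × Cube d), IsProbabilityMeasure D →
        Measure.pi (fun _ : Fin T => D)
          {S | ¬ IsOmnipredictor (lossFamily (lipschitzFunctions d L))
            (𝒞 : Set (𝒳 → Cube d)) ε D k (alg.sectR S)} ≤ ENNReal.ofReal (Real.exp (-β)) := by
  classical
  let J := LossCode d N₁ N₂ M
  let ℒ := lossFamily (lipschitzFunctions d L)
  have hzero : (fun _ _ => 0 : Cube d → Cube d → ℝ) ∈ ℒ :=
    ⟨by simp, fun a y y' => by simpa using mul_nonneg hL dist_nonneg, by simp⟩
  -- Representatives lie in the family itself, hence are bounded and measurable; codes that no loss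
  -- attains get the zero loss.
  have hex : ∀ j : J, ∃ r ∈ ℒ, (∃ ℓ ∈ ℒ, lossCode N₁ N₂ M ℓ = j) → lossCode N₁ N₂ M r = j := by
    intro j
    by_cases h : ∃ ℓ ∈ ℒ, lossCode N₁ N₂ M ℓ = j
    · obtain ⟨r, hr, hrj⟩ := h
      exact ⟨r, hr, fun _ => hrj⟩
    · exact ⟨_, hzero, fun h' => absurd h' h⟩
  choose rep hrep hrepcode using hex
  have hcode : ∀ ℓ ∈ ℒ, ∀ a y, |ℓ a y - rep (lossCode N₁ N₂ M ℓ) a y| ≤ ε / 4 :=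
    fun ℓ hℓ a y => (abs_sub_le_of_lossCode_eq h₁ h₂ hM hL hℓ (hrep _)
      (hrepcode _ ⟨ℓ, hℓ, rfl⟩).symm a y).trans hcover
  have : Nonempty 𝒞 := hne.to_subtype
  -- With the discrete σ-algebra on the finite class, evaluation `(c, x) ↦ c x` is jointly
  -- measurable.
  let _ : MeasurableSpace 𝒞 := ⊤
  have hmeas : ∀ (j : J) (c : 𝒞),
      Measurable fun z : 𝒳 × Cube d => rep j ((c : 𝒳 → Cube d) z.1) z.2 := fun j c =>
    lossFamily.measurable_comp (hrep j) ((h𝒞 c c.2).comp measurable_fst) measurable_snd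
  have hsel : ∀ j : J, ∃ g : (Fin T → 𝒳 × Cube d) → 𝒞, Measurable g ∧ ∀ S (c : 𝒞),
      ∑ i, rep j ((g S : 𝒳 → Cube d) (S i).1) (S i).2
        ≤ ∑ i, rep j ((c : 𝒳 → Cube d) (S i).1) (S i).2 := fun j =>
    exists_measurable_argmin
      (v := fun (S : Fin T → 𝒳 × Cube d) (c : 𝒞) => ∑ i, rep j ((c : 𝒳 → Cube d) (S i).1) (S i).2) fun c =>
      Finset.measurable_sum _ fun i _ => (hmeas j c).comp (measurable_pi_apply i)
  choose g hgm hg using hsel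
  let e : Fin (Fintype.card (J × Fin d)) ≃ J × Fin d := (Fintype.equivFin _).symm
  have happ : Measurable fun p : 𝒞 × 𝒳 => (p.1 : 𝒳 → Cube d) p.2 :=
    measurable_from_prod_countable_right fun c => h𝒞 c c.2
  have hpm : Measurable fun z : (Fin T → 𝒳 × Cube d) × 𝒳 =>
      (fun m => (g (e m).1 z.1 : 𝒳 → Cube d) z.2 (e m).2 :
        Cube (Fintype.card (J × Fin d))) :=
    measurable_pi_lambda _ fun m => (measurable_pi_apply (e m).2).comp
      (happ.comp (((hgm (e m).1).comp measurable_fst).prodMk measurable_snd))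
  refine ⟨_, fun ℓ p m => p (e.symm (lossCode N₁ N₂ M ℓ, m)), Kernel.deterministic _ hpm,
    inferInstance, fun D _ => ?_⟩
  let bad : J × 𝒞 → Set (Fin T → 𝒳 × Cube d) := fun q =>
    {S | T * (ε / 4) ≤ |∑ i, (rep q.1 ((q.2 : 𝒳 → Cube d) (S i).1) (S i).2
      - ∫ z, rep q.1 ((q.2 : 𝒳 → Cube d) z.1) z.2 ∂D)|}
  have hsubset : {S | ¬ IsOmnipredictor ℒ (𝒞 : Set (𝒳 → Cube d)) ε D
      (fun ℓ p m => p (e.symm (lossCode N₁ N₂ M ℓ, m)))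
      ((Kernel.deterministic _ hpm).sectR S)} ⊆ ⋃ q, bad q := by
    intro S hS
    by_contra hbad
    simp only [bad, Set.mem_iUnion, Set.mem_ofPred_eq, not_exists, not_le] at hbad
    exact hS (isOmnipredictor_of_erm hT e h𝒞 hrep hcode D S (fun j => g j S)
      (fun j => hg j S) (fun j c => hbad (j, c)) _
      fun x => by rw [Kernel.sectR_apply, Kernel.deterministic_apply])
  have hcardJ : (Fintype.card (J × 𝒞) : ℝ)
      = ((M + 1 : ℕ) : ℝ) ^ ((N₁ + 1) ^ d * (N₂ + 1) ^ d) * 𝒞.card := by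
    simp [J, LossCode]
  have hcpos : (0 : ℝ) < 𝒞.card := by exact_mod_cast hne.card_pos
  have hbound : (Measure.pi fun _ : Fin T => D).real (⋃ q, bad q) ≤ Real.exp (-β) := by
    calc _ ≤ ∑ q, (Measure.pi fun _ : Fin T => D).real (bad q) :=
          measureReal_iUnion_fintype_le _
      _ ≤ ∑ q : J × 𝒞, 2 * Real.exp (-(2 * T * (ε / 4) ^ 2)) :=
          Finset.sum_le_sum fun q _ =>
            hoeffding_pi D T (hmeas q.1 q.2) (fun z => (hrep q.1).1 _ _) (by positivity)
      _ = Real.exp (Real.log (2 * 𝒞.card)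
            + ((N₁ + 1) ^ d * (N₂ + 1) ^ d : ℝ) * Real.log (M + 1) - T * ε ^ 2 / 8) := by
          rw [Finset.sum_const, Finset.card_univ, nsmul_eq_mul, hcardJ, sub_eq_add_neg,
            Real.exp_add, Real.exp_add, Real.exp_log (by positivity),
            show ((N₁ + 1) ^ d * (N₂ + 1) ^ d : ℝ)
              = (((N₁ + 1) ^ d * (N₂ + 1) ^ d : ℕ) : ℝ) by push_cast; rfl,
            Real.exp_nat_mul, Real.exp_log (by positivity)]
          push_cast
          ring_nf
      _ ≤ _ := Real.exp_le_exp.2 (by linarith)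
  refine (measure_mono hsubset).trans ?_
  rw [← ofReal_measureReal (measure_ne_top _ _)]
  exact ENNReal.ofReal_le_ofReal hbound

/-! ### The sample size -/

/-- One term of the exponential series gives `A ^ d ≤ exp A * d!`, and `d! ≤ d ^ d`. -/
lemma pow_le_exp_mul_rpow {A : ℝ} (hA : 0 ≤ A) {d : ℕ} (hd : 1 ≤ d) :
    A ^ d ≤ Real.exp A * (d : ℝ) ^ (3 * (d : ℝ) / 2 + 1) := by
  have hd' : (1 : ℝ) ≤ d := by exact_mod_cast hd
  have h₁ : A ^ d ≤ Real.exp A * d.factorial :=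
    (div_le_iff₀ (by positivity)).1 (Real.pow_div_factorial_le_exp A hA d)
  have h₂ : (d.factorial : ℝ) ≤ (d : ℝ) ^ d := by exact_mod_cast d.factorial_le_pow
  have h₃ : (d : ℝ) ^ d ≤ (d : ℝ) ^ (3 * (d : ℝ) / 2 + 1) := by
    rw [← Real.rpow_natCast]
    exact Real.rpow_le_rpow_of_exponent_le hd' (by linarith)
  exact h₁.trans (mul_le_mul_of_nonneg_left (h₂.trans h₃) (Real.exp_pos _).le)

/-- For `l < 1` the power is smaller than `l`; the loss is at most `2 ^ (3d/2) ≤ 4 ^ d` because `2l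
≥ 1`. -/
lemma le_four_pow_mul_rpow {l : ℝ} (hl : 1 / 2 ≤ l) (d : ℕ) :
    l ≤ 4 ^ d * l ^ (3 * (d : ℝ) / 2 + 1) := by
  have hl0 : 0 < l := by linarith
  have h : (1 : ℝ) ≤ 4 ^ d * l ^ (3 * (d : ℝ) / 2) := by
    calc (1 : ℝ) ≤ (2 * l) ^ (3 * (d : ℝ) / 2) := Real.one_le_rpow (by linarith) (by positivity)
      _ = 2 ^ (3 * (d : ℝ) / 2) * l ^ (3 * (d : ℝ) / 2) := Real.mul_rpow (by norm_num) hl0.le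
      _ ≤ 4 ^ d * l ^ (3 * (d : ℝ) / 2) := by
        refine mul_le_mul_of_nonneg_right ?_ (by positivity)
        rw [show (4 : ℝ) = 2 ^ (2 : ℝ) by norm_num, ← Real.rpow_natCast,
          ← Real.rpow_mul (by norm_num)]
        refine Real.rpow_le_rpow_of_exponent_le (by norm_num) ?_
        have : (0 : ℝ) ≤ d := d.cast_nonneg
        linarith
  rw [Real.rpow_add hl0, Real.rpow_one, ← mul_assoc]
  exact le_mul_of_one_le_left hl0.le h

/-- Everything is compared with `Q = L ^ d / ε ^ (4d) ≥ 1`, using `ε < 1` and `ε < L`. The final `+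
1` pays for rounding `T` up. -/
lemma sample_size_le {b L ε l C : ℝ} {d N₁ N₂ M : ℕ} (hb : 0 < b) (hd : 1 ≤ d) (hε : 0 < ε)
    (hε1 : ε < 1) (hLε : ε < L) (hC : 2 ≤ C) (hl : l = Real.log (L * C / ε))
    (h₁ : (N₁ : ℝ) + 1 ≤ 26 / ε) (h₂ : (N₂ : ℝ) + 1 ≤ 26 * L / ε) (hM : (M : ℝ) + 1 ≤ 14 / ε) :
    8 / ε ^ 2 * (Real.log (2 * C) + ((N₁ + 1) ^ d * (N₂ + 1) ^ d : ℝ) * Real.log (M + 1)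
      + b / ε ^ (2 * d)) + 1
      ≤ (242 + 16 * b) * Real.exp 2704 * (L ^ d * (d : ℝ) ^ (3 * (d : ℝ) / 2 + 1) *
            l ^ (3 * (d : ℝ) / 2 + 1) / ε ^ (4 * d + 2)) := by
  have hL : 0 < L := hε.trans hLε
  have hCl : Real.log C ≤ l := by
    rw [hl]
    refine Real.log_le_log (by linarith) ?_
    rw [le_div_iff₀ hε]
    nlinarith
  have h2l : Real.log 2 ≤ l := (Real.log_le_log (by norm_num) hC).trans hCl
  have hhalf : 1 / 2 ≤ l := by linarith [Real.log_two_gt_d9]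
  have hl0 : 0 < l := by linarith
  set Q : ℝ := L ^ d / ε ^ (4 * d) with hQ
  have hQ0 : 0 < Q := by positivity
  have hεpow : ∀ m n : ℕ, m ≤ n → ε ^ n ≤ ε ^ m := fun m n h =>
    pow_le_pow_of_le_one hε.le hε1.le h
  have hinv : 1 / ε ^ (2 * d) ≤ Q := by
    rw [hQ, div_le_div_iff₀ (by positivity) (by positivity), one_mul]
    calc ε ^ (4 * d) ≤ ε ^ (d + 2 * d) := hεpow _ _ (by omega)
      _ = ε ^ d * ε ^ (2 * d) := pow_add _ _ _
      _ ≤ L ^ d * ε ^ (2 * d) := by gcongr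
  have hQ1 : 1 ≤ Q := le_trans
    (by rw [le_div_iff₀ (by positivity), one_mul]; exact pow_le_one₀ hε.le hε1.le) hinv
  have hent : ((N₁ + 1) ^ d * (N₂ + 1) ^ d : ℝ) * Real.log (M + 1) ≤ 14 * 676 ^ d * Q := by
    -- The crude `log u ≤ u` costs one factor `1/ε`, which is affordable since `2d + 1 ≤ 4d`.
    have hlog : Real.log ((M : ℝ) + 1) ≤ 14 / ε :=
      (Real.log_le_self (by positivity)).trans hM
    have hlog0 : 0 ≤ Real.log ((M : ℝ) + 1) := Real.log_nonneg (by simp)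
    calc _ ≤ ((26 / ε) ^ d * (26 * L / ε) ^ d) * (14 / ε) := by gcongr
      _ = 14 * 676 ^ d * (L ^ d / ε ^ (2 * d + 1)) := by
        rw [← mul_pow, show 26 / ε * (26 * L / ε) = 676 * L / ε ^ 2 by field_simp; norm_num,
          div_pow, mul_pow, ← pow_mul, pow_succ]
        field_simp
      _ ≤ 14 * 676 ^ d * Q := by
        rw [hQ]
        gcongr 14 * 676 ^ d * (L ^ d / ?_)
        exact hεpow _ _ (by omega)
  have hlogC : Real.log (2 * C) ≤ 2 * l * Q := by
    rw [Real.log_mul (by norm_num) (by linarith)]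
    nlinarith
  have hbQ : b / ε ^ (2 * d) ≤ b * Q := by
    rw [div_eq_mul_one_div]
    exact mul_le_mul_of_nonneg_left hinv hb.le
  have h676 : (1 : ℝ) ≤ 676 ^ d := one_le_pow₀ (by norm_num)
  have hP := pow_le_exp_mul_rpow (A := 2704) (by norm_num) hd
  have hR := le_four_pow_mul_rpow hhalf d
  set P : ℝ := (d : ℝ) ^ (3 * (d : ℝ) / 2 + 1)
  set R : ℝ := l ^ (3 * (d : ℝ) / 2 + 1)
  have hR0 : 0 ≤ R := by positivity
  have hε2 : ε ^ 2 ≤ 1 := pow_le_one₀ hε.le hε1.le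
  calc _ ≤ 8 / ε ^ 2 * (2 * l * Q + 14 * 676 ^ d * Q + b * Q) + Q / ε ^ 2 := by
        refine add_le_add (mul_le_mul_of_nonneg_left (by linarith) (by positivity)) ?_
        rw [le_div_iff₀ (by positivity)]
        linarith
    _ = (16 * l + (112 * 676 ^ d + 8 * b + 1)) * (Q / ε ^ 2) := by field_simp; ring
    -- Since `l ≥ 1/2`, each term without `l` is doubled: `242 = 16 + 2 · 112 + 2 · 1`.
    _ ≤ ((242 + 16 * b) * 676 ^ d * l) * (Q / ε ^ 2) := by
        refine mul_le_mul_of_nonneg_right ?_ (by positivity)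
        have e₁ : 16 * l ≤ 16 * (676 ^ d * l) := by nlinarith
        have e₂ : (112 : ℝ) * 676 ^ d ≤ 224 * (676 ^ d * l) := by nlinarith
        have e₃ : (1 : ℝ) ≤ 2 * (676 ^ d * l) := by nlinarith
        have e₄ : 8 * b ≤ 16 * b * (676 ^ d * l) := by nlinarith
        linarith
    _ ≤ ((242 + 16 * b) * (676 ^ d * (4 ^ d * R))) * (Q / ε ^ 2) := by
        rw [mul_assoc (242 + 16 * b)]
        gcongr
    _ = ((242 + 16 * b) * (2704 ^ d * R)) * (Q / ε ^ 2) := by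
        rw [← mul_assoc (676 ^ d), ← mul_pow]
        norm_num
    _ ≤ ((242 + 16 * b) * (Real.exp 2704 * P * R)) * (Q / ε ^ 2) := by gcongr
    _ = _ := by rw [hQ, pow_add ε]; field_simp

lemma natCeil_add_one_le {ε u : ℝ} (hε1 : ε ≤ u) (hε : 0 < ε) {A : ℝ} (hA : 0 ≤ A) :
    (⌈A * u / ε⌉₊ : ℝ) + 1 ≤ (A + 2) * u / ε := by
  have h := Nat.ceil_lt_add_one (a := A * u / ε) (by have := hε.trans_le hε1; positivity)
  have h1 : 1 ≤ u / ε := (one_le_div hε).2 hε1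
  calc _ ≤ A * u / ε + 2 * (u / ε) := by linarith
    _ = _ := by ring

theorem mainTheorem4 :
    ∀ b : ℝ, 0 < b → ∃ K : ℝ, 0 < K ∧
      ∀ (d : ℕ) (L ε : ℝ) (𝒳 : Type*) [MeasurableSpace 𝒳] (𝒞 : Finset (𝒳 → Cube d)),
        1 ≤ d → 0 < L → 0 < ε → 𝒞.Nonempty → (∀ c ∈ 𝒞, Measurable c) →
        ∃ (T n : ℕ) (k : (Cube d → Cube d → ℝ) → Cube n → Cube d)
          (alg : Kernel ((Fin T → 𝒳 × Cube d) × 𝒳) (Cube n)),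
          IsMarkovKernel alg ∧
          (T : ℝ) ≤ K * (L ^ d * (d : ℝ) ^ (3 * (d : ℝ) / 2 + 1) *
            (log⁺ (L * (𝒞.card : ℝ) / ε)) ^ (3 * (d : ℝ) / 2 + 1) / ε ^ (4 * d + 2)) ∧
          ∀ D : Measure (𝒳 × Cube d), IsProbabilityMeasure D →
            Measure.pi (fun _ : Fin T => D)
              {S | ¬ IsOmnipredictor (lossFamily (lipschitzFunctions d L))
                (𝒞 : Set (𝒳 → Cube d)) ε D k (alg.sectR S)}
              ≤ ENNReal.ofReal (Real.exp (-(b / ε ^ (2 * d)))) := by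
  intro b hb
  refine ⟨(242 + 16 * b) * Real.exp 2704, by positivity, ?_⟩
  intro d L ε 𝒳 _ 𝒞 hd hL hε hne h𝒞
  obtain ⟨c₀, hc₀⟩ := hne
  have hnonneg : 0 ≤ (242 + 16 * b) * Real.exp 2704 *
      (L ^ d * (d : ℝ) ^ (3 * (d : ℝ) / 2 + 1) *
        (log⁺ (L * (𝒞.card : ℝ) / ε)) ^ (3 * (d : ℝ) / 2 + 1) / ε ^ (4 * d + 2)) := by
    have := Real.posLog_nonneg (x := L * (𝒞.card : ℝ) / ε)
    positivity
  -- After this case it may be assumed that `ε < 1`, `|𝒞| ≥ 2` and `ε < L`, so the logarithm is at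
  -- least `log 2`.
  by_cases htriv : ∃ k : (Cube d → Cube d → ℝ) → Cube d → Cube d,
      (∀ ℓ ∈ lossFamily (lipschitzFunctions d L), Measurable (k ℓ)) ∧
      ∀ ℓ ∈ lossFamily (lipschitzFunctions d L), ∀ c ∈ (𝒞 : Set (𝒳 → Cube d)), ∀ x y,
        ℓ (k ℓ (c₀ x)) y - ℓ (c x) y ≤ ε
  · obtain ⟨k, hk, hkε⟩ := htriv
    obtain ⟨alg, halg, h⟩ := exists_omnipredictor_of_forall_le hε.le (h𝒞 c₀ hc₀) hk hkε
    exact ⟨0, d, k, alg, halg, by simpa using hnonneg, fun D hD => by simp [h D hD]⟩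
  have hε1 : ε < 1 := by
    by_contra! h
    exact htriv ⟨fun _ => id, fun _ _ => measurable_id, fun ℓ hℓ c _ x y => by
      linarith [(hℓ.1 (id (c₀ x)) y).2, (hℓ.1 (c x) y).1]⟩
  have hcard : 2 ≤ 𝒞.card := by
    by_contra! h
    refine htriv ⟨fun _ => id, fun _ _ => measurable_id, fun ℓ hℓ c hc x y => ?_⟩
    have : c = c₀ := Finset.card_le_one.1 (by omega) c hc c₀ hc₀
    simpa [this] using hε.le
  have hLε : ε < L := by
    by_contra! h
    -- Every outcome is within `1/2` of the centre, so a constant action minimizing `ℓ(·, y₀)` has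
    -- regret at most `2 · L/2 ≤ ε`.
    let y₀ : Cube d := fun _ => ⟨1 / 2, by norm_num, by norm_num⟩
    have hy₀ : ∀ y : Cube d, dist y y₀ ≤ 1 / 2 := fun y =>
      (dist_pi_le_iff (by norm_num)).2 fun m => by
        rw [Subtype.dist_eq, Real.dist_eq, abs_le]
        constructor <;> simp only [y₀] <;> linarith [(y m).2.1, (y m).2.2]
    have hmin : ∀ ℓ : Cube d → Cube d → ℝ, ∃ a, ℓ ∈ lossFamily (lipschitzFunctions d L) →
        ∀ a', ℓ a y₀ ≤ ℓ a' y₀ := by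
      intro ℓ
      by_cases hℓ : ℓ ∈ lossFamily (lipschitzFunctions d L)
      · obtain ⟨a, -, ha⟩ := isCompact_univ.exists_isMinOn (Set.univ_nonempty (α := Cube d))
          ((lossFamily.continuous hℓ).comp (Continuous.prodMk_left y₀)).continuousOn
        exact ⟨a, fun _ a' => ha (Set.mem_univ a')⟩
      · exact ⟨y₀, fun h' => absurd h' hℓ⟩
    choose a ha using hmin
    refine htriv ⟨fun ℓ _ => a ℓ, fun _ _ => measurable_const, fun ℓ hℓ c _ x y => ?_⟩
    have e₁ := (abs_le.1 (hℓ.2.1 (a ℓ) y y₀)).2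
    have e₂ := (abs_le.1 (hℓ.2.1 (c x) y y₀)).1
    have e₃ := ha ℓ hℓ (c x)
    nlinarith [hy₀ y]
  have hC : (2 : ℝ) ≤ 𝒞.card := by exact_mod_cast hcard
  -- The meshes give the cover radius `2 (ε/24 + ε/24) + ε/12 = ε/4`.
  have hN₁ : 24 / ε ≤ (⌈24 * 1 / ε⌉₊ : ℝ) := by simpa using Nat.le_ceil (24 / ε)
  have hN₂ : 24 * L / ε ≤ (⌈24 * L / ε⌉₊ : ℝ) := Nat.le_ceil _
  have hM : 12 / ε ≤ (⌈12 * 1 / ε⌉₊ : ℝ) := by simpa using Nat.le_ceil (12 / ε)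
  have hsize := sample_size_le (N₁ := ⌈24 * 1 / ε⌉₊) (N₂ := ⌈24 * L / ε⌉₊) (M := ⌈12 * 1 / ε⌉₊)
    hb hd hε hε1 hLε hC rfl
    ((natCeil_add_one_le hε1.le hε (by norm_num)).trans_eq (by norm_num))
    ((natCeil_add_one_le hLε.le hε (by norm_num)).trans_eq (by norm_num))
    ((natCeil_add_one_le hε1.le hε (by norm_num)).trans_eq (by norm_num))
  set N₁ := ⌈24 * 1 / ε⌉₊
  set N₂ := ⌈24 * L / ε⌉₊
  set M := ⌈12 * 1 / ε⌉₊
  have hN₁0 : (0 : ℝ) < N₁ := lt_of_lt_of_le (by positivity) hN₁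
  have hN₂0 : (0 : ℝ) < N₂ := lt_of_lt_of_le (by positivity) hN₂
  have hM0 : (0 : ℝ) < M := lt_of_lt_of_le (by positivity) hM
  have hcover : 2 * (1 / N₁ + L * (1 / N₂)) + 1 / M ≤ ε / 4 := by
    have e₁ : (1 : ℝ) / N₁ ≤ ε / 24 := by
      rw [div_le_div_iff₀ hN₁0 (by norm_num)]
      rw [div_le_iff₀ hε] at hN₁
      linarith
    have e₂ : L * (1 / N₂) ≤ ε / 24 := by
      rw [mul_one_div, div_le_div_iff₀ hN₂0 (by norm_num)]
      rw [div_le_iff₀ hε] at hN₂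
      linarith
    have e₃ : (1 : ℝ) / M ≤ ε / 12 := by
      rw [div_le_div_iff₀ hM0 (by norm_num)]
      rw [div_le_iff₀ hε] at hM
      linarith
    linarith
  set B : ℝ := Real.log (2 * 𝒞.card) + ((N₁ + 1) ^ d * (N₂ + 1) ^ d : ℝ) * Real.log (M + 1)
      + b / ε ^ (2 * d) with hB
  have hB0 : 0 < B := by
    have := Real.log_nonneg (show (1 : ℝ) ≤ 2 * 𝒞.card by linarith)
    have := Real.log_nonneg (show (1 : ℝ) ≤ M + 1 by linarith)
    positivity
  have hT : 8 / ε ^ 2 * B ≤ (⌈8 / ε ^ 2 * B⌉₊ : ℝ) := Nat.le_ceil _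
  obtain ⟨n, k, alg, halg, h⟩ := exists_omnipredictor_of_card_le (T := ⌈8 / ε ^ 2 * B⌉₊)
    (by exact_mod_cast hN₁0) (by exact_mod_cast hN₂0) (by exact_mod_cast hM0)
    (Nat.ceil_pos.2 (by positivity)) hL.le hε.le hcover ⟨c₀, hc₀⟩ h𝒞
    (β := b / ε ^ (2 * d)) (by
      rw [← hB, le_div_iff₀ (by norm_num)]
      have := mul_le_mul_of_nonneg_right hT (sq_nonneg ε)
      rw [show 8 / ε ^ 2 * B * ε ^ 2 = B * 8 by field_simp] at this
      exact this)
  refine ⟨_, n, k, alg, halg, ?_, h⟩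
  have hpos : log⁺ (L * (𝒞.card : ℝ) / ε) = Real.log (L * (𝒞.card : ℝ) / ε) := by
    refine Real.posLog_eq_log ?_
    rw [abs_of_nonneg (by positivity), le_div_iff₀ hε]
    nlinarith
  rw [hpos]
  exact (Nat.ceil_lt_add_one (by positivity)).le.trans hsize
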